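/- Let $\tau\in\mathbb{C}$ with $\operatorname{Im}\tau>0$, let $q=e^{\pi i\tau}$ (so that $0<|q|<1$), and read $q^{r}=e^{\pi i r\tau}$ for rational $r$. Put $$(a;q)_\infty=\prod_{i=0}^{\infty}(1-aq^i),\qquad \psi(q)=\frac{(q^2;q^2)_\infty}{(q;q^2)_\infty},\qquad \Pi_{q}=q^{1/4}\,\psi(q)^2 ,$$ and, for a positive integer $k$, $\Pi_{q^k}=q^{k/4}\,\psi(q^k)^2$. Then all the series below converge, and (a) $\displaystyle \sum_{n=1}^{\infty}\frac{q^n}{(1-q^n)^2}-2\sum_{n=1}^{\infty}\frac{q^{2n}}{(1-q^{2n})^2}=\frac1{24}\left(\frac{\Pi_q^4}{\Pi_{q^2}^2}-1\right)+\frac23\,\Pi_{q^2}^2;$ (b) $\displaystyle \sum_{n=1}^{\infty}\frac{q^n}{(1-q^n)^2}-3\sum_{n=1}^{\infty}\frac{q^{3n}}{(1-q^{3n})^2}=\frac{(\Pi_q^2+3\Pi_{q^3}^2)^2}{12\,\Pi_q\Pi_{q^3}}-\frac1{12};$ (c) $\displaystyle \sum_{n=1}^{\infty}\frac{q^n}{(1-q^n)^2}-4\sum_{n=1}^{\infty}\frac{q^{4n}}{(1-q^{4n})^2}=\frac18\left(\frac{\Pi_q^4}{\Pi_{q^2}^2}-1\right);$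 (d) $\displaystyle \sum_{n=1}^{\infty}\frac{q^{2n}}{(1-q^{2n})^2}-9\sum_{n=1}^{\infty}\frac{q^{18n}}{(1-q^{18n})^2}=\frac{\Pi_{q^3}^3}{\Pi_q}+\frac13\left(\frac{\Pi_{q^3}^3}{\Pi_{q^9}}-1\right);$ (e) $\displaystyle \sum_{n=1}^{\infty}\frac{q^{2n-1}}{(1-q^{2n-1})^2}-3\sum_{n=1}^{\infty}\frac{q^{6n-3}}{(1-q^{6n-3})^2}=\Pi_{q^3}\Pi_q;$ (f) $\displaystyle 6\sum_{n=1}^{\infty}\frac{q^{4n-2}}{(1-q^{2n-1})^4}+\sum_{n=1}^{\infty}\frac{q^{2n-1}}{(1-q^{2n-1})^2}=\Pi_q^4.$ -/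

import Mathlib

open Filter Topology

noncomputable section

/-- The nome `q = e^{π i τ}`. -/
def nome (τ : ℂ) : ℂ := Complex.exp (Real.pi * Complex.I * τ)

/-- The finite `q`-shifted factorial `(a; q)_n = ∏_{i < n} (1 - a q^i)`. -/
def qShifted (a q : ℂ) (n : ℕ) : ℂ := ∏ i ∈ Finset.range n, (1 - a * q ^ i)

/-- The infinite `q`-shifted factorial `(a; q)_∞ = ∏_{i ≥ 0} (1 - a q^i)`; for `|q| < 1` it is
the limit of `(a; q)_n`, see `tendsto_qShifted`. -/
def qShiftedInf (a q : ℂ) : ℂ := ∏' i : ℕ, (1 - a * q ^ i)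

/-- Ramanujan's theta function `ψ(q) = (q²; q²)_∞ / (q; q²)_∞`. -/
def ramanujanPsi (q : ℂ) : ℂ := qShiftedInf (q ^ 2) (q ^ 2) / qShiftedInf q (q ^ 2)

/-- Gosper's constant `Π_q = q^{1/4} ψ(q)²` for `q = e^{π i τ}`, where `q^{1/4} = e^{π i τ / 4}`.
Since `q^k = e^{π i (k τ)}`, the constant `Π_{q^k}` is `gosperPi (k * τ)`. -/
def gosperPi (τ : ℂ) : ℂ :=
  Complex.exp (Real.pi * Complex.I * τ / 4) * ramanujanPsi (nome τ) ^ 2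

end

theorem norm_nome_lt_one {τ : ℂ} (hτ : 0 < τ.im) : ‖nome τ‖ < 1 := by
  rw [nome, Complex.norm_exp, Real.exp_lt_one_iff]
  simp
  positivity

theorem nome_natCast_mul (k : ℕ) (τ : ℂ) : nome (k * τ) = nome τ ^ k := by
  rw [nome, nome, ← Complex.exp_nat_mul]
  ring_nf

theorem tendsto_qShifted (a : ℂ) {q : ℂ} (hq : ‖q‖ < 1) :
    Tendsto (fun n => qShifted a q n) atTop (𝓝 (qShiftedInf a q)) := by
  have hs : Summable fun i : ℕ => ‖-(a * q ^ i)‖ := by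
    simpa [norm_mul, norm_pow] using
      (summable_geometric_of_lt_one (norm_nonneg q) hq).mul_left ‖a‖
  have hm : Multipliable fun i : ℕ => 1 + -(a * q ^ i) := multipliable_one_add_of_summable hs
  simpa only [qShiftedInf, qShifted, sub_eq_add_neg] using hm.hasProd.tendsto_prod_nat

theorem qShiftedInf_ne_zero {a q : ℂ} (hq : ‖q‖ < 1) (ha : ‖a‖ < 1) : qShiftedInf a q ≠ 0 := by
  have hs : Summable fun i : ℕ => ‖-(a * q ^ i)‖ := by
    simpa [norm_mul, norm_pow] using
      (summable_geometric_of_lt_one (norm_nonneg q) hq).mul_left ‖a‖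
  have h := tprod_one_add_ne_zero_of_summable (f := fun i : ℕ => -(a * q ^ i)) (fun i h => by
    have h1 : a * q ^ i = 1 := by linear_combination -h
    have h2 : ‖a‖ * ‖q‖ ^ i = 1 := by rw [← norm_pow, ← norm_mul, h1, norm_one]
    have h3 : ‖q‖ ^ i ≤ 1 := pow_le_one₀ (norm_nonneg q) hq.le
    nlinarith [norm_nonneg a]) hs
  simpa only [qShiftedInf, sub_eq_add_neg] using h

theorem gosperPi_ne_zero {τ : ℂ} (hτ : 0 < τ.im) : gosperPi τ ≠ 0 := by
  have h1 := norm_nome_lt_one hτ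
  have h2 : ‖nome τ ^ 2‖ < 1 := by
    rw [norm_pow]
    exact pow_lt_one₀ (norm_nonneg _) h1 two_ne_zero
  exact mul_ne_zero (Complex.exp_ne_zero _)
    (pow_ne_zero 2 (div_ne_zero (qShiftedInf_ne_zero h2 h2) (qShiftedInf_ne_zero h2 h1)))

/-- `∑ x pⁿ / (1 - x pⁿ)²`, the Lambert series attached to `x` and the nome `p`. -/
noncomputable def lambertSum (p x : ℂ) : ℂ := ∑' n : ℕ, x * p ^ n / (1 - x * p ^ n) ^ 2

theorem prod_range_mul_eq {M : Type*} [CommMonoid M] (f : ℕ → M) (r n : ℕ) :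
    ∏ i ∈ Finset.range (r * n), f i
      = ∏ i ∈ Finset.range n, ∏ j ∈ Finset.range r, f (r * i + j) := by
  induction n with
  | zero => simp
  | succ n ih => rw [Nat.mul_succ, Finset.prod_range_add, ih, Finset.prod_range_succ]

theorem sum_range_mul_eq {M : Type*} [AddCommMonoid M] (f : ℕ → M) (r n : ℕ) :
    ∑ i ∈ Finset.range (r * n), f i
      = ∑ i ∈ Finset.range n, ∑ j ∈ Finset.range r, f (r * i + j) := by
  induction n with
  | zero => simp
  | succ n ih => rw [Nat.mul_succ, Finset.sum_range_add, ih, Finset.sum_range_succ]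

/-! ### The infinite product -/

section Product

variable {p : ℂ}

theorem qShiftedInf_eq_mul (hp : ‖p‖ < 1) (x : ℂ) :
    qShiftedInf x p = (1 - x) * qShiftedInf (p * x) p := by
  refine tendsto_nhds_unique ((tendsto_add_atTop_iff_nat 1).2 (tendsto_qShifted x hp)) ?_
  refine ((tendsto_qShifted (p * x) hp).const_mul (1 - x)).congr fun n => ?_
  rw [qShifted, qShifted, Finset.prod_range_succ']
  simp only [pow_zero, mul_one, mul_comm (1 - x)]
  congr 1
  exact Finset.prod_congr rfl fun i _ => by ring

theorem differentiable_qShiftedInf (hp : ‖p‖ < 1) :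
    Differentiable ℂ fun x => qShiftedInf x p := by
  intro x
  have hs : Summable fun i : ℕ => (‖x‖ + 1) * ‖p‖ ^ i :=
    (summable_geometric_of_lt_one (norm_nonneg p) hp).mul_left _
  have h := hs.hasProdLocallyUniformlyOn_one_add (f := fun i y => -(y * p ^ i))
    (Metric.isOpen_ball (x := x) (ε := 1)) (.of_forall fun n y hy => by
      rw [norm_neg, norm_mul, norm_pow]
      have : ‖y‖ ≤ ‖x‖ + 1 := by
        have := norm_le_norm_add_norm_sub' y x
        rw [mem_ball_iff_norm] at hy
        linarith
      gcongr) (fun n => by fun_prop)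
  have hd := h.differentiableOn (.of_forall fun s =>
    by
      simpa [Finset.prod_fn] using DifferentiableOn.finsetProd (fun _ _ => by fun_prop))
    Metric.isOpen_ball
  have := hd.differentiableAt (Metric.ball_mem_nhds x one_pos)
  simpa only [qShiftedInf, sub_eq_add_neg] using this

theorem qShiftedInf_three_split (hp : ‖p‖ < 1) (x : ℂ) :
    qShiftedInf x p = qShiftedInf x (p ^ 3) * qShiftedInf (x * p) (p ^ 3)
      * qShiftedInf (x * p ^ 2) (p ^ 3) := by
  have hp' : ‖p ^ 3‖ < 1 := by rw [norm_pow]; exact pow_lt_one₀ (norm_nonneg _) hp three_ne_zero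
  refine tendsto_nhds_unique ((tendsto_qShifted x hp).comp
    (tendsto_id.const_mul_atTop' (Nat.succ_pos 2))) ?_
  refine (((tendsto_qShifted x hp').mul (tendsto_qShifted (x * p) hp')).mul
    (tendsto_qShifted (x * p ^ 2) hp')).congr fun n => ?_
  simp only [qShifted, Function.comp, id, prod_range_mul_eq, ← Finset.prod_mul_distrib]
  refine Finset.prod_congr rfl fun i _ => ?_
  simp only [Finset.prod_range_succ, Finset.prod_range_zero]
  ring

theorem qShiftedInf_mul_neg (hp : ‖p‖ < 1) (x : ℂ) :
    qShiftedInf x p * qShiftedInf (-x) p = qShiftedInf (x ^ 2) (p ^ 2) := by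
  have hp' : ‖p ^ 2‖ < 1 := by rw [norm_pow]; exact pow_lt_one₀ (norm_nonneg _) hp two_ne_zero
  refine tendsto_nhds_unique ((tendsto_qShifted x hp).mul (tendsto_qShifted (-x) hp)) ?_
  refine (tendsto_qShifted (x ^ 2) hp').congr fun n => ?_
  simp only [qShifted, ← Finset.prod_mul_distrib]
  exact Finset.prod_congr rfl fun i _ => by ring

theorem qShiftedInf_mul_cube_roots (hp : ‖p‖ < 1) {w : ℂ} (hw : w ^ 2 + w + 1 = 0) (x : ℂ) :
    qShiftedInf x p * qShiftedInf (w * x) p * qShiftedInf (w ^ 2 * x) p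
      = qShiftedInf (x ^ 3) (p ^ 3) := by
  have hp' : ‖p ^ 3‖ < 1 := by rw [norm_pow]; exact pow_lt_one₀ (norm_nonneg _) hp three_ne_zero
  refine tendsto_nhds_unique (((tendsto_qShifted x hp).mul (tendsto_qShifted (w * x) hp)).mul
    (tendsto_qShifted (w ^ 2 * x) hp)) ?_
  refine (tendsto_qShifted (x ^ 3) hp').congr fun n => ?_
  simp only [qShifted, ← Finset.prod_mul_distrib]
  refine Finset.prod_congr rfl fun i _ => ?_
  have h (t : ℂ) : (1 - t) * (1 - w * t) * (1 - w ^ 2 * t) = 1 - t ^ 3 := by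
    linear_combination (-t + w * t ^ 2 - (w - 1) * t ^ 3) * hw
  rw [← pow_mul, mul_comm 3 i, pow_mul, ← mul_pow, ← h]
  ring

end Product

/-! ### The Lambert series -/

section Lambert

variable {p x : ℂ}

theorem one_sub_norm_le_norm_one_sub_mul_pow (hp : ‖p‖ < 1) (n : ℕ) :
    1 - ‖x‖ ≤ ‖1 - x * p ^ n‖ := by
  have h1 : ‖x * p ^ n‖ ≤ ‖x‖ := by
    rw [norm_mul, norm_pow]
    exact mul_le_of_le_one_right (norm_nonneg _) (pow_le_one₀ (norm_nonneg _) hp.le)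
  have h2 := norm_sub_norm_le 1 (x * p ^ n)
  rw [norm_one] at h2
  linarith

theorem norm_lambert_term_le (hp : ‖p‖ < 1) {r : ℝ} (hr : r < 1) (hx : ‖x‖ ≤ r) (n : ℕ) :
    ‖x * p ^ n / (1 - x * p ^ n) ^ 2‖ ≤ ‖p‖ ^ n / (1 - r) ^ 2 := by
  have h := one_sub_norm_le_norm_one_sub_mul_pow (x := x) hp n
  rw [norm_div, norm_pow, norm_mul, norm_pow]
  have h1 : ‖x‖ * ‖p‖ ^ n ≤ ‖p‖ ^ n :=
    mul_le_of_le_one_left (by positivity) (hx.trans hr.le)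
  have h2 : 0 < 1 - r := by linarith
  gcongr
  linarith

theorem summable_lambert (hp : ‖p‖ < 1) (hx : ‖x‖ < 1) :
    Summable fun n : ℕ => x * p ^ n / (1 - x * p ^ n) ^ 2 :=
  .of_norm_bounded ((summable_geometric_of_lt_one (norm_nonneg p) hp).div_const _)
    (norm_lambert_term_le hp hx le_rfl)

theorem one_sub_mul_pow_ne_zero (hp : ‖p‖ < 1) (hx : ‖x‖ < 1) (n : ℕ) : 1 - x * p ^ n ≠ 0 := by
  have := one_sub_norm_le_norm_one_sub_mul_pow (x := x) hp n
  rw [← norm_pos_iff]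
  linarith

theorem lambertSum_eq_add (hp : ‖p‖ < 1) (hx : ‖x‖ < 1) :
    lambertSum p x = x / (1 - x) ^ 2 + lambertSum p (p * x) := by
  rw [lambertSum, (summable_lambert hp hx).tsum_eq_zero_add, lambertSum]
  simp only [pow_zero, mul_one]
  congr 1
  exact tsum_congr fun n => by ring_nf

theorem differentiableOn_lambertSum (hp : ‖p‖ < 1) :
    DifferentiableOn ℂ (lambertSum p) (Metric.ball 0 1) := by
  intro x hx
  rw [mem_ball_zero_iff] at hx
  obtain ⟨r, hxr, hr⟩ := exists_between hx
  have hd : DifferentiableOn ℂ (lambertSum p) (Metric.ball 0 r) := by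
    refine Complex.differentiableOn_tsum_of_summable_norm
      ((summable_geometric_of_lt_one (norm_nonneg p) hp).div_const ((1 - r) ^ 2))
      (fun n => ?_) Metric.isOpen_ball fun n y hy => ?_
    · refine DifferentiableOn.div (by fun_prop) (by fun_prop) fun y hy => ?_
      rw [mem_ball_zero_iff] at hy
      exact pow_ne_zero 2 (one_sub_mul_pow_ne_zero hp (hy.trans hr) n)
    · rw [mem_ball_zero_iff] at hy
      exact norm_lambert_term_le hp hr hy.le n
  exact (hd.differentiableAt (Metric.isOpen_ball.mem_nhds
    (by rwa [mem_ball_zero_iff]))).differentiableWithinAt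

theorem lambertSum_two_split (hp : ‖p‖ < 1) (hx : ‖x‖ < 1) :
    lambertSum p x = lambertSum (p ^ 2) x + lambertSum (p ^ 2) (x * p) := by
  have hp' : ‖p ^ 2‖ < 1 := by rw [norm_pow]; exact pow_lt_one₀ (norm_nonneg _) hp two_ne_zero
  have hxp : ‖x * p‖ < 1 := by
    rw [norm_mul]; exact mul_lt_one_of_nonneg_of_lt_one_left (norm_nonneg _) hx hp.le
  refine tendsto_nhds_unique ((summable_lambert hp hx).hasSum.tendsto_sum_nat.comp
    (tendsto_id.const_mul_atTop' Nat.two_pos)) ?_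
  refine ((summable_lambert hp' hx).hasSum.tendsto_sum_nat.add
    (summable_lambert hp' hxp).hasSum.tendsto_sum_nat).congr fun n => ?_
  simp only [Function.comp, id, sum_range_mul_eq, ← Finset.sum_add_distrib]
  refine Finset.sum_congr rfl fun i _ => ?_
  simp only [Finset.sum_range_succ, Finset.sum_range_zero]
  ring

theorem lambertSum_three_split (hp : ‖p‖ < 1) (hx : ‖x‖ < 1) :
    lambertSum p x = lambertSum (p ^ 3) x + lambertSum (p ^ 3) (x * p)
      + lambertSum (p ^ 3) (x * p ^ 2) := by
  have hp' : ‖p ^ 3‖ < 1 := by rw [norm_pow]; exact pow_lt_one₀ (norm_nonneg _) hp three_ne_zero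
  have hxp (n : ℕ) : ‖x * p ^ n‖ < 1 := by
    rw [norm_mul, norm_pow]
    exact mul_lt_one_of_nonneg_of_lt_one_left (norm_nonneg _) hx
      (pow_le_one₀ (norm_nonneg _) hp.le)
  refine tendsto_nhds_unique ((summable_lambert hp hx).hasSum.tendsto_sum_nat.comp
    (tendsto_id.const_mul_atTop' (Nat.succ_pos 2))) ?_
  refine (((summable_lambert hp' hx).hasSum.tendsto_sum_nat.add
    (summable_lambert hp' (by simpa using hxp 1)).hasSum.tendsto_sum_nat).add
    (summable_lambert hp' (hxp 2)).hasSum.tendsto_sum_nat).congr fun n => ?_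
  simp only [Function.comp, id, sum_range_mul_eq, ← Finset.sum_add_distrib]
  refine Finset.sum_congr rfl fun i _ => ?_
  simp only [Finset.sum_range_succ, Finset.sum_range_zero]
  ring

theorem lambertSum_add_neg (hp : ‖p‖ < 1) (hx : ‖x‖ < 1) :
    lambertSum p x + lambertSum p (-x) = 4 * lambertSum (p ^ 2) (x ^ 2) := by
  have hx' : ‖-x‖ < 1 := by rwa [norm_neg]
  rw [lambertSum, lambertSum, ← (summable_lambert hp hx).tsum_add (summable_lambert hp hx'),
    lambertSum, ← tsum_mul_left]
  refine tsum_congr fun n => ?_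
  have h1 := one_sub_mul_pow_ne_zero hp hx n
  have h2 := one_sub_mul_pow_ne_zero hp hx' n
  have h (t : ℂ) (h1 : 1 - t ≠ 0) (h2 : 1 + t ≠ 0) :
      t / (1 - t) ^ 2 + -t / (1 + t) ^ 2 = 4 * (t ^ 2 / (1 - t ^ 2) ^ 2) := by
    have h3 : 1 - t ^ 2 = (1 - t) * (1 + t) := by ring
    rw [h3]
    field_simp
    ring
  have := h (x * p ^ n) h1 (by convert h2 using 1; ring)
  convert this using 2 <;> ring

theorem lambertSum_add_cube_roots (hp : ‖p‖ < 1) (hx : ‖x‖ < 1) {w : ℂ}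
    (hw : w ^ 2 + w + 1 = 0) :
    lambertSum p x + lambertSum p (w * x) + lambertSum p (w ^ 2 * x)
      = 9 * lambertSum (p ^ 3) (x ^ 3) := by
  have hw3 : w ^ 3 = 1 := by linear_combination (w - 1) * hw
  have hw1 : ‖w‖ = 1 := by
    have : ‖w‖ ^ 3 = 1 := by rw [← norm_pow, hw3, norm_one]
    exact (pow_eq_one_iff_of_nonneg (norm_nonneg _) three_ne_zero).1 this
  have hx1 : ‖w * x‖ < 1 := by rwa [norm_mul, hw1, one_mul]
  have hx2 : ‖w ^ 2 * x‖ < 1 := by rwa [norm_mul, norm_pow, hw1, one_pow, one_mul]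
  rw [lambertSum, lambertSum, ← (summable_lambert hp hx).tsum_add (summable_lambert hp hx1),
    lambertSum, ← ((summable_lambert hp hx).add (summable_lambert hp hx1)).tsum_add
      (summable_lambert hp hx2), lambertSum, ← tsum_mul_left]
  refine tsum_congr fun n => ?_
  have h0 := one_sub_mul_pow_ne_zero hp hx n
  have h1 := one_sub_mul_pow_ne_zero hp hx1 n
  have h2 := one_sub_mul_pow_ne_zero hp hx2 n
  have h (t : ℂ) (h0 : 1 - t ≠ 0) (h1 : 1 - w * t ≠ 0) (h2 : 1 - w ^ 2 * t ≠ 0) :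
      t / (1 - t) ^ 2 + w * t / (1 - w * t) ^ 2 + w ^ 2 * t / (1 - w ^ 2 * t) ^ 2
        = 9 * (t ^ 3 / (1 - t ^ 3) ^ 2) := by
    have h3 : (1 - w * t) * (1 - w ^ 2 * t) = 1 + t + t ^ 2 := by
      linear_combination (-t + (w - 1) * t ^ 2) * hw
    have h4 : w * t / (1 - w * t) ^ 2 + w ^ 2 * t / (1 - w ^ 2 * t) ^ 2
        = -t * (1 + 4 * t + t ^ 2) / (1 + t + t ^ 2) ^ 2 := by
      rw [div_add_div _ _ (pow_ne_zero 2 h1) (pow_ne_zero 2 h2), ← mul_pow, h3]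
      congr 1
      linear_combination (t - 4 * t ^ 2 * (w - 1) + t ^ 3 * (w ^ 3 - w + 1)) * hw
    have h5 : 1 + t + t ^ 2 ≠ 0 := h3 ▸ mul_ne_zero h1 h2
    have h6 : 1 - t ^ 3 = (1 - t) * (1 + t + t ^ 2) := by ring
    rw [add_assoc, h4, h6]
    field_simp
    ring
  have := h (x * p ^ n) h0 (by convert h1 using 1; ring) (by convert h2 using 1; ring)
  convert this using 2 <;> ring_nf

end Lambert

/-! ### Functions on an annulus with a multiplicative period -/

/-- The annulus `‖p‖ < ‖a‖ < ‖p‖⁻¹`. -/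
def annulus (p : ℂ) : Set ℂ := {a | ‖p‖ < ‖a‖ ∧ ‖p‖ * ‖a‖ < 1}

section Annulus

variable {p : ℂ}

theorem isOpen_annulus (p : ℂ) : IsOpen (annulus p) :=
  (isOpen_lt continuous_const continuous_norm).inter
    (isOpen_lt (continuous_const.mul continuous_norm) continuous_const)

theorem one_mem_annulus (hp : ‖p‖ < 1) : (1 : ℂ) ∈ annulus p := by
  simpa [annulus] using hp

theorem ne_zero_of_mem_annulus {a : ℂ} (ha : a ∈ annulus p) : a ≠ 0 :=
  norm_pos_iff.1 ((norm_nonneg p).trans_lt ha.1)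

theorem norm_mul_lt_one_of_mem_annulus {a : ℂ} (ha : a ∈ annulus p) : ‖p * a‖ < 1 := by
  rw [norm_mul]; exact ha.2

theorem norm_div_lt_one_of_mem_annulus {a : ℂ} (ha : a ∈ annulus p) : ‖p / a‖ < 1 := by
  rw [norm_div, div_lt_one (norm_pos_iff.2 (ne_zero_of_mem_annulus ha))]; exact ha.1

theorem isPreconnected_annulus (hp0 : p ≠ 0) : IsPreconnected (annulus p) := by
  have hp0' : 0 < ‖p‖ := norm_pos_iff.2 hp0
  have h : annulus p = Complex.exp '' (Complex.re ⁻¹' Set.Ioo (Real.log ‖p‖) (-Real.log ‖p‖)) := by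
    ext a
    constructor
    · intro ha
      have ha0 := ne_zero_of_mem_annulus ha
      have ha0' : 0 < ‖a‖ := norm_pos_iff.2 ha0
      refine ⟨Complex.log a, ⟨?_, ?_⟩, Complex.exp_log ha0⟩
      · rw [Complex.log_re]
        exact Real.log_lt_log hp0' ha.1
      · rw [Complex.log_re]
        have := Real.log_lt_log (by positivity) ha.2
        rw [Real.log_mul hp0'.ne' ha0'.ne', Real.log_one] at this
        linarith
    · rintro ⟨u, ⟨h1, h2⟩, rfl⟩
      rw [Real.log_lt_iff_lt_exp hp0'] at h1
      refine ⟨by rwa [Complex.norm_exp], ?_⟩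
      rw [Complex.norm_exp]
      have h3 := Real.exp_lt_exp.2 h2
      rw [Real.exp_neg, Real.exp_log hp0'] at h3
      calc ‖p‖ * Real.exp u.re < ‖p‖ * ‖p‖⁻¹ := by gcongr
        _ = 1 := mul_inv_cancel₀ hp0'.ne'
  rw [h]
  refine IsPreconnected.image ?_ _ Complex.continuous_exp.continuousOn
  exact ((convex_Ioo _ _).linear_preimage Complex.reLm).isPreconnected

theorem eq_of_differentiableOn_annulus_of_periodic (hp0 : p ≠ 0) (hp : ‖p‖ < 1) {G : ℂ → ℂ}
    (hd : DifferentiableOn ℂ G (annulus p))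
    (hG : ∀ a, 1 < ‖a‖ → ‖p‖ * ‖a‖ < 1 → G (p * a) = G a) {a b : ℂ} (ha : a ∈ annulus p)
    (hb : b ∈ annulus p) : G a = G b := by
  have hp0' : 0 < ‖p‖ := norm_pos_iff.2 hp0
  set K : Set ℂ := {a | ‖p‖ ≤ ‖a‖ ^ 2 ∧ ‖p‖ * ‖a‖ ^ 2 ≤ 1} with hK
  have hKs : K ⊆ annulus p := by
    rintro x ⟨h1, h2⟩
    have := norm_nonneg x
    constructor
    · by_contra! h
      nlinarith
    · by_contra! h
      nlinarith
  have hKc : IsCompact K := by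
    refine Metric.isCompact_of_isClosed_isBounded
      ((isClosed_le continuous_const (continuous_norm.pow 2)).inter
        (isClosed_le (continuous_const.mul (continuous_norm.pow 2)) continuous_const)) ?_
    refine (Metric.isBounded_ball (x := (0 : ℂ)) (r := ‖p‖⁻¹)).subset fun x hx => ?_
    rw [mem_ball_zero_iff, ← one_div, lt_div_iff₀ hp0', mul_comm]
    exact (hKs hx).2
  obtain ⟨c, hc, hmax⟩ := hKc.exists_isMaxOn ⟨1, by simp [hK, hp.le]⟩
    (hd.continuousOn.mono hKs).norm
  have hmax' : IsMaxOn (norm ∘ G) (annulus p) c := by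
    intro x hx
    change ‖G x‖ ≤ ‖G c‖
    have hx0 : 0 < ‖x‖ := norm_pos_iff.2 (ne_zero_of_mem_annulus hx)
    by_cases h1 : ‖p‖ ≤ ‖x‖ ^ 2
    · by_cases h2 : ‖p‖ * ‖x‖ ^ 2 ≤ 1
      · exact hmax ⟨h1, h2⟩
      · rw [not_le] at h2
        have hx1 : 1 < ‖x‖ := by
          by_contra! h
          nlinarith [pow_le_one₀ hx0.le h (n := 2)]
        rw [← hG x hx1 hx.2]
        refine hmax ⟨?_, ?_⟩
        · rw [norm_mul]
          nlinarith
        · rw [norm_mul]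
          have := pow_le_one₀ (by positivity) hx.2.le (n := 2)
          nlinarith
    · rw [not_le] at h1
      have hxp : p * (x / p) = x := mul_div_cancel₀ x hp0
      have hx1 : ‖x‖ < 1 := by
        by_contra! h
        nlinarith
      have hn : ‖x / p‖ = ‖x‖ / ‖p‖ := norm_div _ _
      have hm : ‖p‖ * ‖x / p‖ = ‖x‖ := by rw [hn]; field_simp
      have h2 : 1 < ‖x / p‖ := by rw [hn, one_lt_div hp0']; exact hx.1
      have := hG (x / p) h2 (hm ▸ hx1)
      rw [hxp] at this
      rw [this]
      refine hmax ⟨?_, ?_⟩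
      · nlinarith
      · have : ‖p‖ * ‖x / p‖ ^ 2 = ‖x‖ ^ 2 / ‖p‖ := by rw [hn]; field_simp
        rw [this, div_le_one hp0']
        exact h1.le
  have := Complex.eqOn_of_isPreconnected_of_isMaxOn_norm (isPreconnected_annulus hp0)
    (isOpen_annulus p) hd (hKs hc) hmax'
  rw [this ha, this hb]
  rfl

end Annulus

/-! ### The theta function and the Weierstrass function in multiplicative form -/

/-- The theta function `(x; p)_∞ (p / x; p)_∞`. -/
noncomputable def thetaProd (p x : ℂ) : ℂ := qShiftedInf x p * qShiftedInf (p / x) p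

/-- The function `∑_{n ∈ ℤ} a pⁿ / (1 - a pⁿ)²` on the annulus: up to an additive constant the
Weierstrass function with multiplicative period `p`. -/
noncomputable def lambertP (p a : ℂ) : ℂ :=
  a / (1 - a) ^ 2 + lambertSum p (p * a) + lambertSum p (p / a)

section Addition

variable {p a b x : ℂ}

theorem thetaProd_eq_mul (hp : ‖p‖ < 1) (x : ℂ) :
    thetaProd p x = (1 - x) * (qShiftedInf (p * x) p * qShiftedInf (p / x) p) := by
  rw [thetaProd, qShiftedInf_eq_mul hp x, mul_assoc]

theorem thetaProd_one (hp : ‖p‖ < 1) : thetaProd p 1 = 0 := by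
  rw [thetaProd_eq_mul hp, sub_self, zero_mul]

theorem mul_thetaProd_mul_period (hp0 : p ≠ 0) (hp : ‖p‖ < 1) (hx : x ≠ 0) :
    x * thetaProd p (p * x) = -thetaProd p x := by
  rw [thetaProd_eq_mul hp x, thetaProd, div_mul_cancel_left₀ hp0, qShiftedInf_eq_mul hp x⁻¹, ← div_eq_mul_inv]
  field_simp
  ring

theorem thetaProd_inv (hp : ‖p‖ < 1) (hx : x ≠ 0) : x * thetaProd p x⁻¹ = -thetaProd p x := by
  rw [thetaProd_eq_mul hp x, thetaProd_eq_mul hp x⁻¹, div_inv_eq_mul, ← div_eq_mul_inv]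
  field_simp
  ring

theorem differentiableAt_thetaProd (hp : ‖p‖ < 1) (hx : x ≠ 0) :
    DifferentiableAt ℂ (thetaProd p) x := by
  have h := differentiable_qShiftedInf hp
  exact (h x).mul ((h (p / x)).comp x (by fun_prop (disch := assumption)))

theorem thetaProd_ne_zero (hp : ‖p‖ < 1) (hx : x ∈ annulus p) (hx1 : x ≠ 1) :
    thetaProd p x ≠ 0 := by
  rw [thetaProd_eq_mul hp]
  exact mul_ne_zero (sub_ne_zero.2 hx1.symm)
    (mul_ne_zero (qShiftedInf_ne_zero hp (norm_mul_lt_one_of_mem_annulus hx))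
      (qShiftedInf_ne_zero hp (norm_div_lt_one_of_mem_annulus hx)))

theorem lambertP_mul_period (hp0 : p ≠ 0) (hp : ‖p‖ < 1) (h1 : 1 < ‖a‖) (h2 : ‖p‖ * ‖a‖ < 1) :
    lambertP p (p * a) = lambertP p a := by
  have ha0 : a ≠ 0 := norm_pos_iff.1 (one_pos.trans h1)
  have ha1 : a - 1 ≠ 0 := by
    rw [sub_ne_zero]; rintro rfl; simp at h1
  have e1 := lambertSum_eq_add hp (x := p * a) (by rwa [norm_mul])
  have e2 := lambertSum_eq_add hp (x := a⁻¹) (by rw [norm_inv]; exact inv_lt_one_of_one_lt₀ h1)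
  have e3 : p / (p * a) = a⁻¹ := by field_simp
  rw [lambertP, lambertP, e1, e3, e2, ← div_eq_mul_inv]
  have e4 : a⁻¹ / (1 - a⁻¹) ^ 2 = a / (1 - a) ^ 2 := by
    have : 1 - a ≠ 0 := by rw [← neg_ne_zero, neg_sub]; exact ha1
    have h3 : 1 - a⁻¹ = (a - 1) / a := by field_simp
    rw [h3, ← neg_sub 1 a]
    field_simp
  rw [e4]
  ring

theorem deriv_eq_zero_of_inv_invariant {r : ℂ → ℂ} (hr : DifferentiableAt ℂ r 1)
    (h : ∀ a, r a⁻¹ = r a) : deriv r 1 = 0 := by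
  have h1 := hr.hasDerivAt
  have h2 : HasDerivAt (fun a => r a⁻¹) (deriv r 1 * -(1 ^ 2)⁻¹) 1 := by
    refine HasDerivAt.comp (1 : ℂ) (by simpa using h1) (hasDerivAt_inv one_ne_zero)
  simp only [h] at h2
  have := h1.unique h2
  simp only [one_pow, inv_one, mul_neg, mul_one] at this
  exact self_eq_neg.1 this

/-- The difference of two values of the Weierstrass function as a product of theta functions. -/
theorem lambertP_sub (hp0 : p ≠ 0) (hp : ‖p‖ < 1) (ha : a ∈ annulus p) (ha1 : a ≠ 1)
    (hb : b ∈ annulus p) (hb1 : b ≠ 1) :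
    lambertP p a - lambertP p b = a * qShiftedInf p p ^ 4 * thetaProd p (a * b)
      * thetaProd p (b / a) / (thetaProd p a ^ 2 * thetaProd p b ^ 2) := by
  have hb0 := ne_zero_of_mem_annulus hb
  have hθb := thetaProd_ne_zero hp hb hb1
  set R : ℂ → ℂ := fun a => a * qShiftedInf p p ^ 4 * thetaProd p (a * b)
      * thetaProd p (b / a) / (thetaProd p a ^ 2 * thetaProd p b ^ 2) with hR
  set r : ℂ → ℂ := fun a => qShiftedInf p p ^ 4 * (thetaProd p (a * b) * thetaProd p (b / a))
      / ((qShiftedInf (p * a) p * qShiftedInf (p / a) p) ^ 2 * thetaProd p b ^ 2) with hr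
  have hRr (x : ℂ) : R x = x / (1 - x) ^ 2 * r x := by
    simp only [hR, hr]
    rw [thetaProd_eq_mul hp x, div_mul_div_comm]
    congr 1 <;> ring
  have hW := differentiable_qShiftedInf hp
  have hA := (isOpen_annulus p).mem_nhds (one_mem_annulus hp)
  have hrd : DifferentiableOn ℂ r (annulus p) := by
    intro x hx
    have hx0 := ne_zero_of_mem_annulus hx
    refine DifferentiableAt.differentiableWithinAt ?_
    refine DifferentiableAt.div (.const_mul (.mul ?_ ?_) _) (.mul_const (.pow (.mul ?_ ?_) _) _) ?_
    · exact (differentiableAt_thetaProd hp (mul_ne_zero hx0 hb0)).comp x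
        (differentiableAt_id.mul_const b)
    · exact (differentiableAt_thetaProd hp (div_ne_zero hb0 hx0)).comp x
        ((differentiableAt_const b).div differentiableAt_id hx0)
    · exact (hW (p * x)).comp x (by fun_prop)
    · exact (hW (p / x)).comp x (by fun_prop (disch := assumption))
    · exact mul_ne_zero (pow_ne_zero 2 (mul_ne_zero
        (qShiftedInf_ne_zero hp (norm_mul_lt_one_of_mem_annulus hx))
        (qShiftedInf_ne_zero hp (norm_div_lt_one_of_mem_annulus hx)))) (pow_ne_zero 2 hθb)
  have hr1 : r 1 = 1 := by
    have := qShiftedInf_ne_zero hp hp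
    simp only [hr, one_mul, mul_one, div_one]
    field_simp
  have hr' : deriv r 1 = 0 := by
    refine deriv_eq_zero_of_inv_invariant (hrd.differentiableAt hA) fun x => ?_
    simp only [hr, div_inv_eq_mul, ← div_eq_mul_inv, inv_mul_eq_div, mul_comm b x]
    congr 1 <;> ring
  set s := dslope r 1 with hs
  have hs1 : s 1 = 0 := by rw [hs, dslope_same, hr']
  set t := dslope s 1 with ht
  have htd : DifferentiableOn ℂ t (annulus p) :=
    (Complex.differentiableOn_dslope hA).2 ((Complex.differentiableOn_dslope hA).2 hrd)
  have hrt {x : ℂ} (hx : x ≠ 1) : r x = 1 + (x - 1) ^ 2 * t x := by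
    have hx' := sub_ne_zero.2 hx
    rw [ht, dslope_of_ne _ hx, slope_def_field, hs1, hs, dslope_of_ne _ hx, slope_def_field, hr1]
    field_simp
    ring
  set G : ℂ → ℂ := fun x =>
    lambertSum p (p * x) + lambertSum p (p / x) - lambertP p b - x * t x with hG
  have hGR {x : ℂ} (hx : x ≠ 1) : G x = lambertP p x - lambertP p b - R x := by
    have hx' : 1 - x ≠ 0 := sub_ne_zero.2 hx.symm
    simp only [hRr, hrt hx, hG, lambertP]
    field_simp
    ring
  have hGd : DifferentiableOn ℂ G (annulus p) := by
    have hL := differentiableOn_lambertSum hp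
    refine DifferentiableOn.sub (DifferentiableOn.sub_const (.add ?_ ?_) _)
      (differentiableOn_id.mul htd)
    · exact hL.comp (by fun_prop) fun x hx =>
        mem_ball_zero_iff.2 (norm_mul_lt_one_of_mem_annulus hx)
    · refine hL.comp (fun x hx => ?_) fun x hx =>
        mem_ball_zero_iff.2 (norm_div_lt_one_of_mem_annulus hx)
      exact ((differentiableAt_const p).div differentiableAt_id
        (ne_zero_of_mem_annulus hx)).differentiableWithinAt
  have hGp (x : ℂ) (h1 : 1 < ‖x‖) (h2 : ‖p‖ * ‖x‖ < 1) : G (p * x) = G x := by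
    have hx0 : x ≠ 0 := norm_pos_iff.1 (one_pos.trans h1)
    have hx1 : x ≠ 1 := by rintro rfl; simp at h1
    have hpx1 : p * x ≠ 1 := by
      intro h
      rw [← norm_mul, h, norm_one] at h2
      exact h2.false
    rw [hGR hpx1, hGR hx1, lambertP_mul_period hp0 hp h1 h2]
    congr 1
    have e1 := mul_thetaProd_mul_period hp0 hp hx0
    have e2 := mul_thetaProd_mul_period hp0 hp (mul_ne_zero hx0 hb0)
    have e3 := mul_thetaProd_mul_period hp0 hp (x := b / (p * x)) (by positivity)
    have e4 : p * (b / (p * x)) = b / x := by field_simp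
    rw [e4] at e3
    have hθx : thetaProd p x ≠ 0 := thetaProd_ne_zero hp ⟨hp.trans h1, h2⟩ hx1
    have f1 : thetaProd p (p * x) = -thetaProd p x / x := by rw [← e1]; field_simp
    have f2 : thetaProd p (p * x * b) = -thetaProd p (x * b) / (x * b) := by
      rw [← e2, ← mul_assoc]; field_simp
    have f3 : thetaProd p (b / (p * x)) = -(b / (p * x) * thetaProd p (b / x)) := by
      rw [e3, neg_neg]
    simp only [hR]
    rw [f1, f2, f3]
    field_simp
  have hGb : G b = 0 := by
    rw [hGR hb1]
    simp [hR, hb0, thetaProd_one hp]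
  have := eq_of_differentiableOn_annulus_of_periodic hp0 hp hGd hGp ha hb
  rw [hGb, hGR ha1] at this
  exact sub_eq_zero.1 this

end Addition

/-! ### Values of the Weierstrass function at torsion points -/

section Values

variable {q : ℂ}

theorem norm_pow_lt_one {q : ℂ} (hq : ‖q‖ < 1) {n : ℕ} (hn : n ≠ 0) : ‖q ^ n‖ < 1 := by
  rw [norm_pow]; exact pow_lt_one₀ (norm_nonneg _) hq hn

theorem ramanujanPsi_ne_zero (hq : ‖q‖ < 1) : ramanujanPsi q ≠ 0 :=
  div_ne_zero (qShiftedInf_ne_zero (norm_pow_lt_one hq two_ne_zero)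
    (norm_pow_lt_one hq two_ne_zero)) (qShiftedInf_ne_zero (norm_pow_lt_one hq two_ne_zero) hq)

theorem pow_mem_annulus (hq0 : q ≠ 0) (hq : ‖q‖ < 1) {m n : ℕ} (h : n < m) :
    q ^ n ∈ annulus (q ^ m) := by
  have h0 : 0 < ‖q‖ := norm_pos_iff.2 hq0
  simp only [annulus, Set.mem_ofPred_eq, norm_pow]
  refine ⟨pow_lt_pow_right_of_lt_one₀ h0 hq h, ?_⟩
  rw [← pow_add]
  exact pow_lt_one₀ h0.le hq (by omega)

theorem ne_one_of_norm_lt_one {x : ℂ} (hx : ‖x‖ < 1) : x ≠ 1 := by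
  rintro rfl; simp at hx

theorem mem_annulus_of_norm_eq_one {p x : ℂ} (hp : ‖p‖ < 1) (hx : ‖x‖ = 1) : x ∈ annulus p := by
  simpa [annulus, hx] using hp

theorem lambertP_eq_add {p x : ℂ} (hp : ‖p‖ < 1) (hx : ‖x‖ < 1) :
    lambertP p x = lambertSum p x + lambertSum p (p / x) := by
  rw [lambertP, lambertSum_eq_add hp hx]

theorem ramanujanPsi_sq (hq : ‖q‖ < 1) :
    ramanujanPsi (q ^ 2) = qShiftedInf (q ^ 2) (q ^ 2) * qShiftedInf (-q ^ 2) (q ^ 2)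
      / (qShiftedInf q (q ^ 2) * qShiftedInf (-q) (q ^ 2)) := by
  have hp := norm_pow_lt_one hq two_ne_zero
  rw [ramanujanPsi, qShiftedInf_mul_neg hp, qShiftedInf_mul_neg hp]

theorem lambertP_sub_neg_one (hq0 : q ≠ 0) (hq : ‖q‖ < 1) :
    lambertP (q ^ 2) q - lambertP (q ^ 2) (-1)
      = ramanujanPsi q ^ 8 / (4 * ramanujanPsi (q ^ 2) ^ 4) := by
  have hp := norm_pow_lt_one hq two_ne_zero
  have hp0 : q ^ 2 ≠ 0 := pow_ne_zero 2 hq0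
  have h1 := qShiftedInf_ne_zero hp hq
  have h2 := qShiftedInf_ne_zero hp hp
  have h3 := qShiftedInf_ne_zero hp (a := -q) (by rwa [norm_neg])
  have h4 := qShiftedInf_ne_zero hp (a := -q ^ 2) (by rwa [norm_neg])
  rw [lambertP_sub hp0 hp (by simpa using pow_mem_annulus hq0 hq one_lt_two)
    (ne_one_of_norm_lt_one hq) (mem_annulus_of_norm_eq_one hp (by simp)) (by norm_num),
    ramanujanPsi_sq hq, ramanujanPsi]
  have e1 : thetaProd (q ^ 2) q = qShiftedInf q (q ^ 2) ^ 2 := by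
    rw [thetaProd, show q ^ 2 / q = q by field_simp, ← sq]
  have e2 : thetaProd (q ^ 2) (q * -1) = qShiftedInf (-q) (q ^ 2) ^ 2 := by
    rw [thetaProd, show q ^ 2 / (q * -1) = -q by field_simp, show q * -1 = -q by ring, ← sq]
  have e3 : thetaProd (q ^ 2) (-1 / q) = qShiftedInf (-q) (q ^ 2) ^ 2 / q := by
    have := thetaProd_inv hp (mul_ne_zero hq0 (neg_ne_zero.2 one_ne_zero))
    rw [show (q * -1)⁻¹ = -1 / q by field_simp, e2] at this
    rw [eq_div_iff hq0]
    linear_combination -this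
  have e4 : thetaProd (q ^ 2) (-1) = 2 * qShiftedInf (-q ^ 2) (q ^ 2) ^ 2 := by
    rw [thetaProd_eq_mul hp, show q ^ 2 * -1 = -q ^ 2 by ring,
      show q ^ 2 / -1 = -q ^ 2 by ring]
    ring
  rw [e1, e2, e3, e4]
  field_simp
  ring

theorem lambertP_sub_neg (hq0 : q ≠ 0) (hq : ‖q‖ < 1) :
    lambertP (q ^ 2) q - lambertP (q ^ 2) (-q) = 4 * q * ramanujanPsi (q ^ 2) ^ 4 := by
  have hp := norm_pow_lt_one hq two_ne_zero
  have hp0 : q ^ 2 ≠ 0 := pow_ne_zero 2 hq0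
  have hq' : ‖-q‖ < 1 := by rwa [norm_neg]
  have h1 := qShiftedInf_ne_zero hp hq
  have h2 := qShiftedInf_ne_zero hp hp
  have h3 := qShiftedInf_ne_zero hp hq'
  have hm : q ∈ annulus (q ^ 2) := by simpa using pow_mem_annulus hq0 hq one_lt_two
  rw [lambertP_sub hp0 hp hm (ne_one_of_norm_lt_one hq) (by simpa [annulus] using hm)
    (ne_one_of_norm_lt_one hq'), ramanujanPsi_sq hq]
  have e1 : thetaProd (q ^ 2) q = qShiftedInf q (q ^ 2) ^ 2 := by
    rw [thetaProd, show q ^ 2 / q = q by field_simp, ← sq]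
  have e2 : thetaProd (q ^ 2) (-q) = qShiftedInf (-q) (q ^ 2) ^ 2 := by
    rw [thetaProd, show q ^ 2 / -q = -q by field_simp, ← sq]
  have e4 : thetaProd (q ^ 2) (-1) = 2 * qShiftedInf (-q ^ 2) (q ^ 2) ^ 2 := by
    rw [thetaProd_eq_mul hp, show q ^ 2 * -1 = -q ^ 2 by ring,
      show q ^ 2 / -1 = -q ^ 2 by ring]
    ring
  have e3 : thetaProd (q ^ 2) (q * -q) = 2 * qShiftedInf (-q ^ 2) (q ^ 2) ^ 2 := by
    rw [← e4, thetaProd, thetaProd, show q * -q = -q ^ 2 by ring,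
      show q ^ 2 / -q ^ 2 = -1 by field_simp, show q ^ 2 / -1 = -q ^ 2 by ring, mul_comm]
  rw [show -q / q = -1 by field_simp, e1, e2, e3, e4]
  field_simp
  ring

theorem lambertP_sub_cube_root (hq0 : q ≠ 0) (hq : ‖q‖ < 1) {w : ℂ} (hw : w ^ 2 + w + 1 = 0) :
    lambertP (q ^ 2) q - lambertP (q ^ 2) w
      = ramanujanPsi q ^ 6 / (3 * ramanujanPsi (q ^ 3) ^ 2) := by
  have hp := norm_pow_lt_one hq two_ne_zero
  have hp0 : q ^ 2 ≠ 0 := pow_ne_zero 2 hq0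
  have hw3 : w ^ 3 = 1 := by linear_combination (w - 1) * hw
  have hw0 : w ≠ 0 := by rintro rfl; simp at hw
  have hw1 : w ≠ 1 := by rintro rfl; norm_num at hw
  have hwn : ‖w‖ = 1 := by
    have : ‖w‖ ^ 3 = 1 := by rw [← norm_pow, hw3, norm_one]
    exact (pow_eq_one_iff_of_nonneg (norm_nonneg _) three_ne_zero).1 this
  have h (x : ℂ) (hx : ‖x‖ < 1) : qShiftedInf (w * x) (q ^ 2) ≠ 0 ∧
      qShiftedInf (w ^ 2 * x) (q ^ 2) ≠ 0 :=
    ⟨qShiftedInf_ne_zero hp (by rwa [norm_mul, hwn, one_mul]),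
      qShiftedInf_ne_zero hp (by rwa [norm_mul, norm_pow, hwn, one_pow, one_mul])⟩
  have h1 := qShiftedInf_ne_zero hp hq
  have h2 := qShiftedInf_ne_zero hp hp
  obtain ⟨h3, h4⟩ := h q hq
  obtain ⟨h5, h6⟩ := h (q ^ 2) hp
  have hm : q ∈ annulus (q ^ 2) := by simpa using pow_mem_annulus hq0 hq one_lt_two
  rw [lambertP_sub hp0 hp hm (ne_one_of_norm_lt_one hq) (mem_annulus_of_norm_eq_one hp hwn) hw1]
  have e1 : thetaProd (q ^ 2) q = qShiftedInf q (q ^ 2) ^ 2 := by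
    rw [thetaProd, show q ^ 2 / q = q by field_simp, ← sq]
  have hwi : w⁻¹ = w ^ 2 := by field_simp; exact hw3.symm
  have e2 : thetaProd (q ^ 2) (q * w)
      = qShiftedInf (w * q) (q ^ 2) * qShiftedInf (w ^ 2 * q) (q ^ 2) := by
    rw [thetaProd, show q ^ 2 / (q * w) = w ^ 2 * q by rw [← hwi]; field_simp, mul_comm q w]
  have e3 : thetaProd (q ^ 2) (w / q)
      = -w / q * (qShiftedInf (w * q) (q ^ 2) * qShiftedInf (w ^ 2 * q) (q ^ 2)) := by
    have hn : w ^ 2 * q ≠ 0 := mul_ne_zero (pow_ne_zero 2 hw0) hq0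
    have := thetaProd_inv hp hn
    rw [show (w ^ 2 * q)⁻¹ = w / q by rw [mul_inv, ← hwi, inv_inv, div_eq_mul_inv]] at this
    have e : thetaProd (q ^ 2) (w ^ 2 * q)
        = qShiftedInf (w * q) (q ^ 2) * qShiftedInf (w ^ 2 * q) (q ^ 2) := by
      rw [thetaProd, show q ^ 2 / (w ^ 2 * q) = w * q by rw [← hwi]; field_simp, mul_comm]
    rw [e] at this
    rw [← mul_right_inj' hn, this, ← one_mul (-_), ← hw3]
    field_simp
  have e4 : thetaProd (q ^ 2) w = (1 - w) *
      (qShiftedInf (w * q ^ 2) (q ^ 2) * qShiftedInf (w ^ 2 * q ^ 2) (q ^ 2)) := by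
    rw [thetaProd_eq_mul hp, mul_comm _ w, div_eq_mul_inv, hwi, mul_comm _ (w ^ 2)]
  have e5 : ramanujanPsi (q ^ 3) = ramanujanPsi q
      * (qShiftedInf (w * q ^ 2) (q ^ 2) * qShiftedInf (w ^ 2 * q ^ 2) (q ^ 2))
      / (qShiftedInf (w * q) (q ^ 2) * qShiftedInf (w ^ 2 * q) (q ^ 2)) := by
    rw [ramanujanPsi, ramanujanPsi, show (q ^ 3) ^ 2 = (q ^ 2) ^ 3 by ring,
      ← qShiftedInf_mul_cube_roots hp hw, ← qShiftedInf_mul_cube_roots hp hw]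
    field_simp
  have hw' : 1 - w ≠ 0 := sub_ne_zero.2 hw1.symm
  have e6 : (1 - w) ^ 2 = -3 * w := by linear_combination hw
  rw [e5, e1, e2, e3, e4, mul_pow (1 - w), e6, ramanujanPsi]
  field_simp

theorem ramanujanPsi_eq_base_six (hq : ‖q‖ < 1) :
    ramanujanPsi q = qShiftedInf (q ^ 2) (q ^ 6) * qShiftedInf (q ^ 4) (q ^ 6)
        * qShiftedInf (q ^ 6) (q ^ 6)
      / (qShiftedInf q (q ^ 6) * qShiftedInf (q ^ 3) (q ^ 6) * qShiftedInf (q ^ 5) (q ^ 6)) := by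
  have hp := norm_pow_lt_one hq two_ne_zero
  rw [ramanujanPsi, qShiftedInf_three_split hp, qShiftedInf_three_split hp]
  ring_nf

theorem ramanujanPsi_cube (q : ℂ) :
    ramanujanPsi (q ^ 3) = qShiftedInf (q ^ 6) (q ^ 6) / qShiftedInf (q ^ 3) (q ^ 6) := by
  rw [ramanujanPsi, ← pow_mul]

theorem lambertP_sub_base_six (hq0 : q ≠ 0) (hq : ‖q‖ < 1) :
    lambertP (q ^ 6) q - lambertP (q ^ 6) (q ^ 3)
        = q * ramanujanPsi q ^ 2 * ramanujanPsi (q ^ 3) ^ 2 ∧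
      lambertP (q ^ 6) (q ^ 2) - lambertP (q ^ 6) (q ^ 3)
        = q ^ 2 * ramanujanPsi (q ^ 3) ^ 6 / ramanujanPsi q ^ 2 := by
  have hp := norm_pow_lt_one hq (n := 6) (by norm_num)
  have hp0 : q ^ 6 ≠ 0 := pow_ne_zero 6 hq0
  have h1 := qShiftedInf_ne_zero hp hq
  have h (n : ℕ) (hn : n ≠ 0) := qShiftedInf_ne_zero hp (norm_pow_lt_one hq hn)
  have h2 := h 2 (by norm_num)
  have h3 := h 3 (by norm_num)
  have h4 := h 4 (by norm_num)
  have h5 := h 5 (by norm_num)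
  have h6 := h 6 (by norm_num)
  have m1 : q ∈ annulus (q ^ 6) := by
    simpa using pow_mem_annulus hq0 hq (show 1 < 6 by norm_num)
  have m2 := pow_mem_annulus hq0 hq (show 2 < 6 by norm_num)
  have m3 := pow_mem_annulus hq0 hq (show 3 < 6 by norm_num)
  have n2 := ne_one_of_norm_lt_one (norm_pow_lt_one hq (n := 2) (by norm_num))
  have n3 := ne_one_of_norm_lt_one (norm_pow_lt_one hq (n := 3) (by norm_num))
  have t1 : thetaProd (q ^ 6) q = qShiftedInf q (q ^ 6) * qShiftedInf (q ^ 5) (q ^ 6) := by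
    rw [thetaProd, show q ^ 6 / q = q ^ 5 by field_simp]
  have t2 : thetaProd (q ^ 6) (q ^ 2)
      = qShiftedInf (q ^ 2) (q ^ 6) * qShiftedInf (q ^ 4) (q ^ 6) := by
    rw [thetaProd, show q ^ 6 / q ^ 2 = q ^ 4 by field_simp]
  have t3 : thetaProd (q ^ 6) (q ^ 3) = qShiftedInf (q ^ 3) (q ^ 6) ^ 2 := by
    rw [thetaProd, show q ^ 6 / q ^ 3 = q ^ 3 by field_simp, ← sq]
  have t4 : thetaProd (q ^ 6) (q * q ^ 3)
      = qShiftedInf (q ^ 2) (q ^ 6) * qShiftedInf (q ^ 4) (q ^ 6) := by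
    rw [thetaProd, show q ^ 6 / (q * q ^ 3) = q ^ 2 by field_simp, ← pow_succ', mul_comm]
  have t5 : thetaProd (q ^ 6) (q ^ 2 * q ^ 3)
      = qShiftedInf q (q ^ 6) * qShiftedInf (q ^ 5) (q ^ 6) := by
    rw [thetaProd, show q ^ 6 / (q ^ 2 * q ^ 3) = q by field_simp, ← pow_add, mul_comm]
  rw [lambertP_sub hp0 hp m1 (ne_one_of_norm_lt_one hq) m3 n3, lambertP_sub hp0 hp m2 n2 m3 n3,
    ramanujanPsi_cube, ramanujanPsi_eq_base_six hq, t4, t5, t3,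
    show q ^ 3 / q = q ^ 2 by field_simp, show q ^ 3 / q ^ 2 = q by field_simp, t1, t2]
  constructor
  · field_simp
  · field_simp

end Values

/-! ### The Lambert series at torsion points -/

section Evaluation

variable {q : ℂ}

theorem lambertSum_odd (hq : ‖q‖ < 1) :
    lambertSum (q ^ 2) q = lambertSum q q - lambertSum (q ^ 2) (q ^ 2) := by
  rw [lambertSum_two_split hq hq, sq, add_sub_cancel_right]

theorem lambertP_sq_self (hq0 : q ≠ 0) (hq : ‖q‖ < 1) :
    lambertP (q ^ 2) q = 2 * (lambertSum q q - lambertSum (q ^ 2) (q ^ 2)) := by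
  rw [lambertP_eq_add (norm_pow_lt_one hq two_ne_zero) hq, show q ^ 2 / q = q by field_simp,
    lambertSum_odd hq]
  ring

theorem lambertP_sq_neg_one (hq : ‖q‖ < 1) :
    lambertP (q ^ 2) (-1)
      = -1 / 4 + 2 * (4 * lambertSum (q ^ 4) (q ^ 4) - lambertSum (q ^ 2) (q ^ 2)) := by
  have hp := norm_pow_lt_one hq two_ne_zero
  have := lambertSum_add_neg hp hp
  rw [← pow_mul] at this
  rw [lambertP, show q ^ 2 * -1 = -q ^ 2 by ring, show q ^ 2 / -1 = -q ^ 2 by ring]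
  linear_combination 2 * this

theorem lambertP_sq_neg_self (hq0 : q ≠ 0) (hq : ‖q‖ < 1) :
    lambertP (q ^ 2) (-q) = 2 * (4 * (lambertSum (q ^ 2) (q ^ 2) - lambertSum (q ^ 4) (q ^ 4))
      - (lambertSum q q - lambertSum (q ^ 2) (q ^ 2))) := by
  have hp := norm_pow_lt_one hq two_ne_zero
  have h1 := lambertSum_add_neg hp hq
  have h2 := lambertSum_odd hp
  rw [← pow_mul] at h1 h2
  rw [lambertP_eq_add hp (by rwa [norm_neg]), show q ^ 2 / -q = -q by field_simp]
  linear_combination 2 * h1 + 8 * h2 - 2 * lambertSum_odd hq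

theorem lambertP_sq_cube_root (hq : ‖q‖ < 1) {w : ℂ} (hw : w ^ 2 + w + 1 = 0) :
    lambertP (q ^ 2) w
      = -1 / 3 + 9 * lambertSum (q ^ 6) (q ^ 6) - lambertSum (q ^ 2) (q ^ 2) := by
  have hp := norm_pow_lt_one hq two_ne_zero
  have hw3 : w ^ 3 = 1 := by linear_combination (w - 1) * hw
  have hw0 : w ≠ 0 := by rintro rfl; simp at hw
  have hw1 : 1 - w ≠ 0 := by
    rw [sub_ne_zero]; rintro rfl; norm_num at hw
  have h := lambertSum_add_cube_roots hp hp hw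
  rw [← pow_mul] at h
  have hwi : w⁻¹ = w ^ 2 := by field_simp; exact hw3.symm
  have e : w / (1 - w) ^ 2 = -1 / 3 := by
    field_simp
    linear_combination hw
  rw [lambertP, e, div_eq_mul_inv (q ^ 2) w, hwi, mul_comm _ w, mul_comm _ (w ^ 2)]
  linear_combination h

theorem lambertP_base_six (hq0 : q ≠ 0) (hq : ‖q‖ < 1) :
    lambertP (q ^ 6) q = lambertSum (q ^ 2) q - lambertSum (q ^ 6) (q ^ 3) ∧
    lambertP (q ^ 6) (q ^ 2) = lambertSum (q ^ 2) (q ^ 2) - lambertSum (q ^ 6) (q ^ 6) ∧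
    lambertP (q ^ 6) (q ^ 3) = 2 * lambertSum (q ^ 6) (q ^ 3) := by
  have hp := norm_pow_lt_one hq two_ne_zero
  have h6 := norm_pow_lt_one hq (n := 6) (by norm_num)
  have h3 := norm_pow_lt_one hq three_ne_zero
  have e1 := lambertSum_three_split hp hq
  have e2 := lambertSum_three_split hp hp
  simp only [← pow_mul, ← pow_succ', ← pow_add] at e1 e2
  rw [lambertP_eq_add h6 hq, lambertP_eq_add h6 hp, lambertP_eq_add h6 h3,
    show q ^ 6 / q = q ^ 5 by field_simp, show q ^ 6 / q ^ 2 = q ^ 4 by field_simp,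
    show q ^ 6 / q ^ 3 = q ^ 3 by field_simp]
  refine ⟨?_, ?_, ?_⟩
  · linear_combination -e1
  · linear_combination -e2
  · ring

end Evaluation

/-! ### The second derivative at the half period -/

section SecondDerivative

variable {q : ℂ}

theorem lambert_second_difference {x z s : ℂ} (hz : z ≠ 0) (hs : s = z + z⁻¹ - 2)
    (hx : 1 - x ≠ 0) (h1 : 1 - x * z ≠ 0) (h2 : 1 - x / z ≠ 0) :
    x * z / (1 - x * z) ^ 2 + x / z / (1 - x / z) ^ 2 - 2 * (x / (1 - x) ^ 2)
      = s * (x * ((1 + 4 * x + x ^ 2) * (1 - x) ^ 2 - 2 * x ^ 2 * s)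
        / ((1 - x) ^ 2 * ((1 - x) ^ 2 - x * s) ^ 2)) := by
  have h3 : (1 - x) ^ 2 - x * s = (1 - x * z) * (1 - x / z) := by
    rw [hs]; field_simp; ring
  rw [h3]
  have h2' : z - x ≠ 0 := by
    intro h; apply h2; rw [← sub_eq_zero.1 h, div_self hz, sub_self]
  have h4 : 1 - x / z = (z - x) / z := by field_simp
  rw [h4, hs]
  field_simp
  ring

theorem tendsto_tsum_second_difference (hq : ‖q‖ < 1) :
    Tendsto (fun s : ℂ => ∑' n : ℕ, q * (q ^ 2) ^ n *
        ((1 + 4 * (q * (q ^ 2) ^ n) + (q * (q ^ 2) ^ n) ^ 2) * (1 - q * (q ^ 2) ^ n) ^ 2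
          - 2 * (q * (q ^ 2) ^ n) ^ 2 * s)
        / ((1 - q * (q ^ 2) ^ n) ^ 2 * ((1 - q * (q ^ 2) ^ n) ^ 2 - q * (q ^ 2) ^ n * s) ^ 2))
      (𝓝 0) (𝓝 (∑' n : ℕ, q * (q ^ 2) ^ n * (1 + 4 * (q * (q ^ 2) ^ n) + (q * (q ^ 2) ^ n) ^ 2)
        / (1 - q * (q ^ 2) ^ n) ^ 4)) := by
  have hp := norm_pow_lt_one hq two_ne_zero
  set δ := 1 - ‖q‖ with hδ
  have hδ0 : 0 < δ := by linarith
  have hδ1 : δ ≤ 1 := by linarith [norm_nonneg q]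
  have hxn (n : ℕ) : ‖q * (q ^ 2) ^ n‖ ≤ ‖q ^ 2‖ ^ n := by
    rw [norm_mul, norm_pow (q ^ 2)]
    exact mul_le_of_le_one_left (by positivity) hq.le
  refine tendsto_tsum_of_dominated_convergence
    (bound := fun n => ‖q ^ 2‖ ^ n * 26 / (δ ^ 2 * (δ ^ 2 / 2) ^ 2))
    (((summable_geometric_of_lt_one (norm_nonneg _) hp).mul_right 26).div_const _)
    (fun n => ?_) ?_
  · have hx := one_sub_mul_pow_ne_zero hp hq n
    generalize q * (q ^ 2) ^ n = x at hx
    have hc : ContinuousAt (fun s : ℂ => x * ((1 + 4 * x + x ^ 2) * (1 - x) ^ 2 - 2 * x ^ 2 * s)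
        / ((1 - x) ^ 2 * ((1 - x) ^ 2 - x * s) ^ 2)) 0 := by
      refine ContinuousAt.div (by fun_prop) (by fun_prop) ?_
      simpa using hx
    convert hc.tendsto using 2
    field_simp
    ring
  · filter_upwards [Metric.ball_mem_nhds (0 : ℂ) (show 0 < δ ^ 2 / 2 by positivity)] with s hs n
    rw [mem_ball_zero_iff] at hs
    have h1 : δ ≤ ‖1 - q * (q ^ 2) ^ n‖ := one_sub_norm_le_norm_one_sub_mul_pow hp n
    have h2 := hxn n
    have h3 : ‖q ^ 2‖ ^ n ≤ 1 := pow_le_one₀ (norm_nonneg _) hp.le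
    generalize ‖q ^ 2‖ ^ n = B at h2 h3
    generalize q * (q ^ 2) ^ n = x at h1 h2
    have hB : 0 ≤ B := (norm_nonneg x).trans h2
    have hx1 : ‖x‖ ≤ 1 := h2.trans h3
    have hs1 : ‖s‖ ≤ 1 := by nlinarith
    have h4 : ‖1 - x‖ ≤ 2 := by
      have := norm_sub_le 1 x
      rw [norm_one] at this
      linarith
    have h5 : δ ^ 2 / 2 ≤ ‖(1 - x) ^ 2 - x * s‖ := by
      have e1 := norm_sub_norm_le ((1 - x) ^ 2) (x * s)
      rw [norm_pow, norm_mul] at e1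
      have e2 : δ ^ 2 ≤ ‖1 - x‖ ^ 2 := by gcongr
      have e3 : ‖x‖ * ‖s‖ ≤ 1 * (δ ^ 2 / 2) := by gcongr
      linarith
    have h6 : ‖(1 + 4 * x + x ^ 2) * (1 - x) ^ 2 - 2 * x ^ 2 * s‖ ≤ 26 := by
      calc ‖(1 + 4 * x + x ^ 2) * (1 - x) ^ 2 - 2 * x ^ 2 * s‖
          ≤ ‖(1 + 4 * x + x ^ 2) * (1 - x) ^ 2‖ + ‖2 * x ^ 2 * s‖ := norm_sub_le _ _
        _ ≤ (1 + 4 * ‖x‖ + ‖x‖ ^ 2) * ‖1 - x‖ ^ 2 + 2 * ‖x‖ ^ 2 * ‖s‖ := by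
            simp only [norm_mul, norm_pow]
            have : ‖1 + 4 * x + x ^ 2‖ ≤ 1 + 4 * ‖x‖ + ‖x‖ ^ 2 := by
              refine (norm_add₃_le).trans ?_
              simp
            have h2 : ‖(2 : ℂ)‖ = 2 := by simp
            rw [h2]
            gcongr
        _ ≤ (1 + 4 * 1 + 1 ^ 2) * 2 ^ 2 + 2 * 1 ^ 2 * 1 := by gcongr
        _ = 26 := by norm_num
    rw [norm_div, norm_mul, norm_mul, norm_pow, norm_pow]
    gcongr

theorem tsum_second_derivative (hq0 : q ≠ 0) (hq : ‖q‖ < 1) :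
    ∑' n : ℕ, q * (q ^ 2) ^ n * (1 + 4 * (q * (q ^ 2) ^ n) + (q * (q ^ 2) ^ n) ^ 2)
      / (1 - q * (q ^ 2) ^ n) ^ 4 = q * ramanujanPsi q ^ 8 := by
  have hp := norm_pow_lt_one hq two_ne_zero
  have hp0 : q ^ 2 ≠ 0 := pow_ne_zero 2 hq0
  have hW := differentiable_qShiftedInf hp
  have hm : q ∈ annulus (q ^ 2) := by simpa using pow_mem_annulus hq0 hq one_lt_two
  have hq1 := ne_one_of_norm_lt_one hq
  have hs : Tendsto (fun z : ℂ => z + z⁻¹ - 2) (𝓝[≠] 1) (𝓝 0) := by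
    have : ContinuousAt (fun z : ℂ => z + z⁻¹ - 2) 1 := by fun_prop (disch := norm_num)
    convert this.tendsto.mono_left nhdsWithin_le_nhds using 2
    norm_num
  refine tendsto_nhds_unique ((tendsto_tsum_second_difference hq).comp hs) ?_
  have hR : Tendsto (fun z : ℂ => q * qShiftedInf (q ^ 2) (q ^ 2) ^ 4 *
      (qShiftedInf (q ^ 2 * z) (q ^ 2) * qShiftedInf (q ^ 2 / z) (q ^ 2)) ^ 2
      / (thetaProd (q ^ 2) (q * z) ^ 2 * thetaProd (q ^ 2) q ^ 2)) (𝓝[≠] 1)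
      (𝓝 (q * ramanujanPsi q ^ 8)) := by
    have hθ := thetaProd_ne_zero hp hm hq1
    have hc : ContinuousAt (fun z : ℂ => q * qShiftedInf (q ^ 2) (q ^ 2) ^ 4 *
      (qShiftedInf (q ^ 2 * z) (q ^ 2) * qShiftedInf (q ^ 2 / z) (q ^ 2)) ^ 2
      / (thetaProd (q ^ 2) (q * z) ^ 2 * thetaProd (q ^ 2) q ^ 2)) 1 := by
      have hd : ContinuousAt (fun z : ℂ => q ^ 2 / z) 1 :=
        continuousAt_const.div continuousAt_id one_ne_zero
      have hθc : ContinuousAt (fun z : ℂ => thetaProd (q ^ 2) (q * z)) 1 :=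
        ContinuousAt.comp (g := thetaProd (q ^ 2))
          (by simpa using (differentiableAt_thetaProd hp hq0).continuousAt)
          (continuousAt_const.mul continuousAt_id)
      refine ContinuousAt.div (.mul continuousAt_const (.pow (.mul ?_ ?_) _))
        (.mul (.pow hθc _) continuousAt_const) (by simpa using hθ)
      · exact hW.continuous.continuousAt.comp (continuousAt_const.mul continuousAt_id)
      · exact hW.continuous.continuousAt.comp hd
    convert hc.tendsto.mono_left nhdsWithin_le_nhds using 2
    have h1 := qShiftedInf_ne_zero hp hq
    simp only [mul_one, div_one]
    rw [thetaProd, show q ^ 2 / q = q by field_simp, ramanujanPsi]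
    field_simp
  refine hR.congr' ?_
  have hc : ContinuousAt (fun z : ℂ => q * z) 1 := by fun_prop
  have hd : ContinuousAt (fun z : ℂ => q / z) 1 :=
    continuousAt_const.div continuousAt_id one_ne_zero
  have hball := Metric.isOpen_ball (x := (0 : ℂ)) (ε := 1)
  have hqb : q ∈ Metric.ball (0 : ℂ) 1 := mem_ball_zero_iff.2 hq
  filter_upwards [self_mem_nhdsWithin, nhdsWithin_le_nhds (isOpen_ne.mem_nhds one_ne_zero),
    nhdsWithin_le_nhds (hc.preimage_mem_nhds
      ((isOpen_annulus (q ^ 2)).mem_nhds (by simpa using hm))),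
    nhdsWithin_le_nhds (hc.preimage_mem_nhds (hball.mem_nhds (by simpa using hqb))),
    nhdsWithin_le_nhds (hd.preimage_mem_nhds (hball.mem_nhds (by simpa using hqb)))]
    with z hz1 hz0 hza hzb hzd
  have hz1 : z ≠ 1 := hz1
  have hz0 : z ≠ 0 := hz0
  have hzb : ‖q * z‖ < 1 := mem_ball_zero_iff.1 hzb
  have hzd : ‖q / z‖ < 1 := mem_ball_zero_iff.1 hzd
  have hs0 : z + z⁻¹ - 2 ≠ 0 := by
    have : z + z⁻¹ - 2 = (z - 1) ^ 2 / z := by field_simp; ring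
    rw [this]
    exact div_ne_zero (pow_ne_zero 2 (sub_ne_zero.2 hz1)) hz0
  have key := lambertP_sub hp0 hp hza (ne_one_of_norm_lt_one hzb) hm hq1
  have e1 : thetaProd (q ^ 2) (q * z * q) = -thetaProd (q ^ 2) z / z := by
    rw [← mul_thetaProd_mul_period hp0 hp hz0, show q * z * q = q ^ 2 * z by ring]
    field_simp
  have e2 : thetaProd (q ^ 2) (q / (q * z)) = -thetaProd (q ^ 2) z / z := by
    rw [← thetaProd_inv hp hz0, show q / (q * z) = z⁻¹ by field_simp]
    field_simp
  rw [e1, e2, thetaProd_eq_mul hp z, lambertP_eq_add hp hzb, lambertP_eq_add hp hq,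
    show q ^ 2 / q = q by field_simp, show q ^ 2 / (q * z) = q / z by field_simp,
    ← two_mul] at key
  have hsum : lambertSum (q ^ 2) (q * z) + lambertSum (q ^ 2) (q / z)
      - 2 * lambertSum (q ^ 2) q = (z + z⁻¹ - 2) * ∑' n : ℕ, q * (q ^ 2) ^ n *
        ((1 + 4 * (q * (q ^ 2) ^ n) + (q * (q ^ 2) ^ n) ^ 2) * (1 - q * (q ^ 2) ^ n) ^ 2
          - 2 * (q * (q ^ 2) ^ n) ^ 2 * (z + z⁻¹ - 2))
        / ((1 - q * (q ^ 2) ^ n) ^ 2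
          * ((1 - q * (q ^ 2) ^ n) ^ 2 - q * (q ^ 2) ^ n * (z + z⁻¹ - 2)) ^ 2) := by
    have s1 := summable_lambert hp hzb
    have s2 := summable_lambert hp hzd
    have s3 := summable_lambert hp hq
    rw [lambertSum, lambertSum, lambertSum, ← s1.tsum_add s2, ← tsum_mul_left,
      ← (s1.add s2).tsum_sub (s3.mul_left 2), ← tsum_mul_left]
    refine tsum_congr fun n => ?_
    have c1 : q * z * (q ^ 2) ^ n = q * (q ^ 2) ^ n * z := by ring
    have c2 : q / z * (q ^ 2) ^ n = q * (q ^ 2) ^ n / z := by ring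
    have n1 := one_sub_mul_pow_ne_zero hp hzb n
    have n2 := one_sub_mul_pow_ne_zero hp hzd n
    rw [c1] at n1 ⊢
    rw [c2] at n2 ⊢
    exact lambert_second_difference hz0 rfl (one_sub_mul_pow_ne_zero hp hq n) n1 n2
  rw [hsum] at key
  rw [Function.comp, ← mul_right_inj' hs0, key,
    show z + z⁻¹ - 2 = (1 - z) ^ 2 / z by field_simp; ring]
  have t1 := thetaProd_ne_zero hp hza (ne_one_of_norm_lt_one hzb)
  have t2 := thetaProd_ne_zero hp hm hq1
  field_simp

end SecondDerivative

/-! ### Gosper's identities -/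

section Identities

variable {q : ℂ}

theorem exists_primitive_cube_root : ∃ w : ℂ, w ^ 2 + w + 1 = 0 := by
  have h3 : (Real.sqrt 3 : ℂ) ^ 2 = 3 := by
    rw [← Complex.ofReal_pow, Real.sq_sqrt (by norm_num)]; norm_num
  exact ⟨(-1 + Real.sqrt 3 * Complex.I) / 2, by
    linear_combination (Complex.I ^ 2 / 4) * h3 + (3 / 4) * Complex.I_sq⟩

theorem lambertSum_sub_four (hq0 : q ≠ 0) (hq : ‖q‖ < 1) :
    lambertSum q q - 4 * lambertSum (q ^ 4) (q ^ 4)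
      = 1 / 8 * (ramanujanPsi q ^ 8 / ramanujanPsi (q ^ 2) ^ 4 - 1) := by
  have h := lambertP_sub_neg_one hq0 hq
  rw [lambertP_sq_self hq0 hq, lambertP_sq_neg_one hq, mul_comm (4 : ℂ), ← div_div] at h
  linear_combination h / 2

theorem lambertSum_sub_two (hq0 : q ≠ 0) (hq : ‖q‖ < 1) :
    lambertSum q q - 2 * lambertSum (q ^ 2) (q ^ 2)
      = 1 / 24 * (ramanujanPsi q ^ 8 / ramanujanPsi (q ^ 2) ^ 4 - 1)
        + 2 / 3 * (q * ramanujanPsi (q ^ 2) ^ 4) := by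
  have h := lambertP_sub_neg hq0 hq
  rw [lambertP_sq_self hq0 hq, lambertP_sq_neg_self hq0 hq] at h
  linear_combination h / 6 + lambertSum_sub_four hq0 hq / 3

theorem ramanujanPsi_pow_six_div (hq0 : q ≠ 0) (hq : ‖q‖ < 1) :
    ramanujanPsi q ^ 6 / ramanujanPsi (q ^ 3) ^ 2 = 1 + 6 * lambertSum q q
      - 3 * lambertSum (q ^ 2) (q ^ 2) - 27 * lambertSum (q ^ 6) (q ^ 6) := by
  obtain ⟨w, hw⟩ := exists_primitive_cube_root
  have h := lambertP_sub_cube_root hq0 hq hw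
  rw [lambertP_sq_self hq0 hq, lambertP_sq_cube_root hq hw, mul_comm (3 : ℂ), ← div_div] at h
  linear_combination -3 * h

theorem lambertSum_odd_sub_three (hq0 : q ≠ 0) (hq : ‖q‖ < 1) :
    lambertSum (q ^ 2) q - 3 * lambertSum (q ^ 6) (q ^ 3)
      = q * ramanujanPsi q ^ 2 * ramanujanPsi (q ^ 3) ^ 2 := by
  obtain ⟨h1, -, h3⟩ := lambertP_base_six hq0 hq
  have h := (lambertP_sub_base_six hq0 hq).1
  linear_combination h - h1 + h3

theorem lambertSum_cube_odd (hq : ‖q‖ < 1) :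
    lambertSum (q ^ 6) (q ^ 3) = lambertSum (q ^ 3) (q ^ 3) - lambertSum (q ^ 6) (q ^ 6) := by
  have h := lambertSum_odd (norm_pow_lt_one hq three_ne_zero)
  rwa [← pow_mul] at h

theorem ramanujanPsi_cube_pow_six_div (hq0 : q ≠ 0) (hq : ‖q‖ < 1) :
    q ^ 2 * ramanujanPsi (q ^ 3) ^ 6 / ramanujanPsi q ^ 2 = lambertSum (q ^ 2) (q ^ 2)
      + lambertSum (q ^ 6) (q ^ 6) - 2 * lambertSum (q ^ 3) (q ^ 3) := by
  obtain ⟨-, h2, h3⟩ := lambertP_base_six hq0 hq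
  have h := (lambertP_sub_base_six hq0 hq).2
  linear_combination -h + h2 - h3 - 2 * lambertSum_cube_odd hq

theorem lambertSum_sub_three (hq0 : q ≠ 0) (hq : ‖q‖ < 1) :
    lambertSum q q - 3 * lambertSum (q ^ 3) (q ^ 3)
      = (ramanujanPsi q ^ 4 + 3 * q * ramanujanPsi (q ^ 3) ^ 4) ^ 2
        / (12 * ramanujanPsi q ^ 2 * ramanujanPsi (q ^ 3) ^ 2) - 1 / 12 := by
  have h1 := ramanujanPsi_ne_zero hq
  have h3 := ramanujanPsi_ne_zero (norm_pow_lt_one hq three_ne_zero)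
  have e : (ramanujanPsi q ^ 4 + 3 * q * ramanujanPsi (q ^ 3) ^ 4) ^ 2
        / (12 * ramanujanPsi q ^ 2 * ramanujanPsi (q ^ 3) ^ 2)
      = (ramanujanPsi q ^ 6 / ramanujanPsi (q ^ 3) ^ 2
        + 6 * (q * ramanujanPsi q ^ 2 * ramanujanPsi (q ^ 3) ^ 2)
        + 9 * (q ^ 2 * ramanujanPsi (q ^ 3) ^ 6 / ramanujanPsi q ^ 2)) / 12 := by
    field_simp
    ring
  rw [e, ramanujanPsi_pow_six_div hq0 hq, ramanujanPsi_cube_pow_six_div hq0 hq,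
    ← lambertSum_odd_sub_three hq0 hq, lambertSum_odd hq, lambertSum_cube_odd hq]
  ring

theorem lambertSum_sub_nine (hq0 : q ≠ 0) (hq : ‖q‖ < 1) :
    lambertSum (q ^ 2) (q ^ 2) - 9 * lambertSum (q ^ 18) (q ^ 18)
      = q ^ 2 * ramanujanPsi (q ^ 3) ^ 6 / ramanujanPsi q ^ 2
        + 1 / 3 * (ramanujanPsi (q ^ 3) ^ 6 / ramanujanPsi (q ^ 9) ^ 2 - 1) := by
  have h := ramanujanPsi_pow_six_div (pow_ne_zero 3 hq0) (norm_pow_lt_one hq three_ne_zero)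
  simp only [← pow_mul] at h
  linear_combination -ramanujanPsi_cube_pow_six_div hq0 hq - h / 3

end Identities

theorem gosperPi_natCast_mul (k : ℕ) (τ : ℂ) : gosperPi (k * τ)
    = Complex.exp (Real.pi * Complex.I * τ / 4) ^ k * ramanujanPsi (nome τ ^ k) ^ 2 := by
  rw [gosperPi, nome_natCast_mul, ← Complex.exp_nat_mul]
  ring_nf

theorem exp_pow_four_eq_nome (τ : ℂ) :
    Complex.exp (Real.pi * Complex.I * τ / 4) ^ 4 = nome τ := by
  rw [nome, ← Complex.exp_nat_mul]
  congr 1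
  push_cast
  ring

theorem tsum_multiples_eq_lambertSum (q : ℂ) (k : ℕ) :
    ∑' n : ℕ, q ^ (k * (n + 1)) / (1 - q ^ (k * (n + 1))) ^ 2 = lambertSum (q ^ k) (q ^ k) := by
  simp only [lambertSum, pow_mul, pow_succ']

theorem tsum_odd_multiples_eq_lambertSum (q : ℂ) (k : ℕ) :
    ∑' n : ℕ, q ^ (k * (2 * n + 1)) / (1 - q ^ (k * (2 * n + 1))) ^ 2
      = lambertSum (q ^ (2 * k)) (q ^ k) := by
  refine tsum_congr fun n => ?_
  rw [show q ^ (k * (2 * n + 1)) = q ^ k * (q ^ (2 * k)) ^ n by ring]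

theorem summable_fourth_power {q : ℂ} (hq : ‖q‖ < 1) :
    Summable fun n : ℕ => q ^ (4 * n + 2) / (1 - q ^ (2 * n + 1)) ^ 4 := by
  have hp := norm_pow_lt_one hq two_ne_zero
  have hp4 := norm_pow_lt_one hq four_ne_zero
  refine .of_norm_bounded (g := fun n => ‖q ^ 4‖ ^ n / (1 - ‖q‖) ^ 4)
    ((summable_geometric_of_lt_one (norm_nonneg _) hp4).div_const _) fun n => ?_
  have h := one_sub_norm_le_norm_one_sub_mul_pow (x := q) hp n
  have h0 : 0 < 1 - ‖q‖ := by linarith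
  rw [show q ^ (2 * n + 1) = q * (q ^ 2) ^ n by ring, norm_div, norm_pow (1 - _),
    show q ^ (4 * n + 2) = (q ^ 4) ^ n * q ^ 2 by ring, norm_mul, norm_pow (q ^ 4)]
  gcongr
  exact mul_le_of_le_one_right (by positivity) hp.le
/-- Gosper's Lambert series identities. The summation index `n ≥ 1` of the series is written as
`n + 1` with `n : ℕ`, so `2n - 1`, `6n - 3`, `4n - 2` become `2n + 1`, `6n + 3`, `4n + 2`.
The first three conjuncts record the convergence of all series that occur. -/
theorem theorem1p1 (τ q : ℂ) (hτ : 0 < τ.im) (hq : q = nome τ) :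
    (∀ k : ℕ, 1 ≤ k →
      Summable fun n : ℕ => q ^ (k * (n + 1)) / (1 - q ^ (k * (n + 1))) ^ 2) ∧
    (∀ k : ℕ, 1 ≤ k →
      Summable fun n : ℕ => q ^ (k * (2 * n + 1)) / (1 - q ^ (k * (2 * n + 1))) ^ 2) ∧
    (Summable fun n : ℕ => q ^ (4 * n + 2) / (1 - q ^ (2 * n + 1)) ^ 4) ∧
    -- (a)
    (∑' n : ℕ, q ^ (n + 1) / (1 - q ^ (n + 1)) ^ 2)
        - 2 * (∑' n : ℕ, q ^ (2 * (n + 1)) / (1 - q ^ (2 * (n + 1))) ^ 2)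
      = 1 / 24 * (gosperPi τ ^ 4 / gosperPi (2 * τ) ^ 2 - 1)
        + 2 / 3 * gosperPi (2 * τ) ^ 2 ∧
    -- (b)
    (∑' n : ℕ, q ^ (n + 1) / (1 - q ^ (n + 1)) ^ 2)
        - 3 * (∑' n : ℕ, q ^ (3 * (n + 1)) / (1 - q ^ (3 * (n + 1))) ^ 2)
      = (gosperPi τ ^ 2 + 3 * gosperPi (3 * τ) ^ 2) ^ 2
          / (12 * gosperPi τ * gosperPi (3 * τ)) - 1 / 12 ∧
    -- (c)
    (∑' n : ℕ, q ^ (n + 1) / (1 - q ^ (n + 1)) ^ 2)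
        - 4 * (∑' n : ℕ, q ^ (4 * (n + 1)) / (1 - q ^ (4 * (n + 1))) ^ 2)
      = 1 / 8 * (gosperPi τ ^ 4 / gosperPi (2 * τ) ^ 2 - 1) ∧
    -- (d)
    (∑' n : ℕ, q ^ (2 * (n + 1)) / (1 - q ^ (2 * (n + 1))) ^ 2)
        - 9 * (∑' n : ℕ, q ^ (18 * (n + 1)) / (1 - q ^ (18 * (n + 1))) ^ 2)
      = gosperPi (3 * τ) ^ 3 / gosperPi τ
        + 1 / 3 * (gosperPi (3 * τ) ^ 3 / gosperPi (9 * τ) - 1) ∧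
    -- (e)
    (∑' n : ℕ, q ^ (2 * n + 1) / (1 - q ^ (2 * n + 1)) ^ 2)
        - 3 * (∑' n : ℕ, q ^ (6 * n + 3) / (1 - q ^ (6 * n + 3)) ^ 2)
      = gosperPi (3 * τ) * gosperPi τ ∧
    -- (f)
    6 * (∑' n : ℕ, q ^ (4 * n + 2) / (1 - q ^ (2 * n + 1)) ^ 4)
        + (∑' n : ℕ, q ^ (2 * n + 1) / (1 - q ^ (2 * n + 1)) ^ 2)
      = gosperPi τ ^ 4 := by

  have hq1 : ‖q‖ < 1 := hq ▸ norm_nome_lt_one hτ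
  have hq0 : q ≠ 0 := hq ▸ Complex.exp_ne_zero _
  set c := Complex.exp (Real.pi * Complex.I * τ / 4) with hc
  have hc0 : c ≠ 0 := Complex.exp_ne_zero _
  have hcq : c ^ 4 = q := by rw [hc, exp_pow_four_eq_nome, hq]
  have g1 : gosperPi τ = c * ramanujanPsi q ^ 2 := by rw [gosperPi, hq]
  have g2 : gosperPi (2 * τ) = c ^ 2 * ramanujanPsi (q ^ 2) ^ 2 := by
    rw [hq]; exact_mod_cast gosperPi_natCast_mul 2 τ
  have g3 : gosperPi (3 * τ) = c ^ 3 * ramanujanPsi (q ^ 3) ^ 2 := by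
    rw [hq]; exact_mod_cast gosperPi_natCast_mul 3 τ
  have g9 : gosperPi (9 * τ) = c ^ 9 * ramanujanPsi (q ^ 9) ^ 2 := by
    rw [hq]; exact_mod_cast gosperPi_natCast_mul 9 τ
  have n1 := ramanujanPsi_ne_zero hq1
  have n2 := ramanujanPsi_ne_zero (norm_pow_lt_one hq1 two_ne_zero)
  have n3 := ramanujanPsi_ne_zero (norm_pow_lt_one hq1 three_ne_zero)
  have n9 := ramanujanPsi_ne_zero (norm_pow_lt_one hq1 (n := 9) (by norm_num))
  have t (k : ℕ) := tsum_multiples_eq_lambertSum q k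
  have t1 := t 1
  have u (k : ℕ) := tsum_odd_multiples_eq_lambertSum q k
  have u1 := u 1
  simp only [one_mul, mul_one, pow_one] at t1 u1
  have sodd (k : ℕ) (hk : 1 ≤ k) :
      Summable fun n : ℕ => q ^ (k * (2 * n + 1)) / (1 - q ^ (k * (2 * n + 1))) ^ 2 := by
    refine (summable_lambert (norm_pow_lt_one hq1 (n := 2 * k) (by omega))
      (norm_pow_lt_one hq1 (n := k) (by omega))).congr fun n => ?_
    rw [show q ^ (k * (2 * n + 1)) = q ^ k * (q ^ (2 * k)) ^ n by ring]
  refine ⟨fun k hk => ?_, sodd, summable_fourth_power hq1, ?_, ?_, ?_, ?_, ?_, ?_⟩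
  · have := norm_pow_lt_one hq1 (n := k) (by omega)
    simpa only [pow_mul, pow_succ'] using summable_lambert this this
  · rw [t1, t, lambertSum_sub_two hq0 hq1, g1, g2, ← hcq]
    field_simp
  · rw [t1, t, lambertSum_sub_three hq0 hq1, g1, g3]
    congr 1
    rw [div_eq_div_iff (by simp [n1, n3]) (by simp [hc0, n1, n3])]
    generalize ramanujanPsi q = X
    generalize ramanujanPsi (q ^ 3) = Y
    rw [← hcq]
    ring
  · rw [t1, t, lambertSum_sub_four hq0 hq1, g1, g2]
    field_simp
  · rw [t, t, lambertSum_sub_nine hq0 hq1, g1, g3, g9]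
    generalize ramanujanPsi (q ^ 3) = Y at *
    generalize ramanujanPsi q = X at *
    generalize ramanujanPsi (q ^ 9) = Z at *
    rw [← hcq]
    field_simp
  · have u3 := u 3
    simp only [show ∀ n, 3 * (2 * n + 1) = 6 * n + 3 by intro n; ring] at u3
    rw [u1, u3, lambertSum_odd_sub_three hq0 hq1, g1, g3]
    linear_combination -(ramanujanPsi q ^ 2 * ramanujanPsi (q ^ 3) ^ 2) * hcq
  · have s1 := sodd 1 le_rfl
    simp only [one_mul] at s1
    rw [← tsum_mul_left, ← ((summable_fourth_power hq1).mul_left 6).tsum_add s1, g1,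
      mul_pow, hcq, ← pow_mul, ← tsum_second_derivative hq0 hq1]
    refine tsum_congr fun n => ?_
    have h := one_sub_mul_pow_ne_zero (norm_pow_lt_one hq1 two_ne_zero) hq1 n
    rw [show q ^ (2 * n + 1) = q * (q ^ 2) ^ n by ring,
      show q ^ (4 * n + 2) = (q * (q ^ 2) ^ n) ^ 2 by ring]
    generalize q * (q ^ 2) ^ n = x at h
    field_simp
    ring
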